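/- Let $\mathbb{D}$ be the open unit disk in $\mathbb{C}$. Let $H^2$ be the Hardy space of functions $f(z)=\sum_{n\ge 0}a_nz^n$ on $\mathbb{D}$ with $\|f\|^2=\sum|a_n|^2<\infty$ (reproducing kernel $(1-\bar w z)^{-1}$), and let $\mathcal{D}$ be the Dirichlet space of functions $f(z)=\sum_{n\ge 0}a_nz^n$ on $\mathbb{D}$ with $\|f\|^2=\sum (n+1)|a_n|^2<\infty$ (reproducing kernel $\frac{1}{\bar w z}\log\frac{1}{1-\bar w z}$). For $H=H^2$ or $H=\mathcal{D}$, let $M(H)$ be the multiplier algebra, i.e. the functions $m$ on $\mathbb{D}$ such that $f\mapsto mf$ is a bounded linear map of $H$ into itself, and let $H^\infty$ be the algebra of bounded holomorphic functions on $\mathbb{D}$ (which is known to be $M(H^2)$). A set $S\subset\mathbb{D}$ is called a zero set for a class of functions on $\mathbb{D}$ if some function in the class vanishes at every point of $S$ and at no other point of $\mathbb{D}$. Corollary. Let $S\subset\mathbb{D}$ be a set of (distinct) points. (a) If $\sum_{x\in S}(1-|x|^2)<\infty$, then $S$ is a zero set for $H^2$, for $M(H^2)$ and for $H^\infty$. (b)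 If $$\sum_{x\in S\setminus\{0\}}\left(\log\frac{1}{1-|x|^2}\right)^{-1}<\infty,$$ then $S$ is a zero set for the Dirichlet space $\mathcal{D}$ and for its multiplier algebra $M(\mathcal{D})$ (Shapiro–Shields). -/

import Mathlib

open scoped Complex.UnitDisc ComplexConjugate

/-- Admissible weights: `0 < c n ≤ 1` for all `n`. -/
class IsDiscWeight (c : ℕ → ℝ) : Prop where
  pos : ∀ n, 0 < c n
  le_one : ∀ n, c n ≤ 1

/-- The Hilbert space of power series `f(z) = ∑ aₙ zⁿ` on the unit disc with
`‖f‖² = ∑ |aₙ|² / cₙ² < ∞`. The element `f` is stored as the square-summable sequence `aₙ / cₙ`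
(its coordinates in the orthonormal basis `cₙ zⁿ`); see `DiscSpace.coeff`,
`DiscSpace.hasSum_apply`, `DiscSpace.hasSum_norm_sq` and `DiscSpace.exists_of_coeff`. -/
def DiscSpace (_c : ℕ → ℝ) : Type := lp (fun _ : ℕ => ℂ) 2

namespace DiscSpace

noncomputable instance (c : ℕ → ℝ) : NormedAddCommGroup (DiscSpace c) :=
  inferInstanceAs (NormedAddCommGroup (lp (fun _ : ℕ => ℂ) 2))

noncomputable instance (c : ℕ → ℝ) : InnerProductSpace ℂ (DiscSpace c) :=
  inferInstanceAs (InnerProductSpace ℂ (lp (fun _ : ℕ => ℂ) 2))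

instance (c : ℕ → ℝ) : CompleteSpace (DiscSpace c) :=
  inferInstanceAs (CompleteSpace (lp (fun _ : ℕ => ℂ) 2))

/-- The underlying `ℓ²` sequence. -/
def seq {c : ℕ → ℝ} (f : DiscSpace c) : lp (fun _ : ℕ => ℂ) 2 := f

/-- The `n`-th Taylor coefficient `aₙ` of `f`. -/
noncomputable def coeff {c : ℕ → ℝ} (f : DiscSpace c) (n : ℕ) : ℂ := (c n : ℂ) * seq f n

theorem memlp_kernelVec (c : ℕ → ℝ) [hc : IsDiscWeight c] (z : 𝔻) :
    Memℓp (fun n : ℕ => (c n : ℂ) * conj (z : ℂ) ^ n) 2 := by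
  apply memℓp_gen
  have hs : Summable (fun n : ℕ => (‖(z : ℂ)‖ ^ 2) ^ n) :=
    summable_geometric_of_lt_one (by positivity) z.sq_norm_lt_one
  refine hs.of_nonneg_of_le (fun n => by positivity) (fun n => ?_)
  have h0 := (hc.pos n).le
  have h1 : (c n) ^ 2 ≤ 1 := pow_le_one₀ h0 (hc.le_one n)
  have h2 : ‖(c n : ℂ) * conj (z : ℂ) ^ n‖ = c n * ‖(z : ℂ)‖ ^ n := by
    rw [norm_mul, norm_pow, RCLike.norm_conj, Complex.norm_real, Real.norm_of_nonneg h0]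
  rw [h2]
  norm_num
  rw [mul_pow, ← pow_mul, ← pow_mul, mul_comm n 2]
  exact mul_le_of_le_one_left (by positivity) h1

/-- The sequence `cₙ z̄ⁿ`, which represents the reproducing kernel at `z`. -/
noncomputable def kernelVec (c : ℕ → ℝ) [IsDiscWeight c] (z : 𝔻) : DiscSpace c :=
  (⟨fun n : ℕ => (c n : ℂ) * conj (z : ℂ) ^ n, memlp_kernelVec c z⟩ : lp (fun _ : ℕ => ℂ) 2)

theorem hasSum_inner_kernelVec (c : ℕ → ℝ) [IsDiscWeight c] (f : DiscSpace c) (z : 𝔻) :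
    HasSum (fun n : ℕ => coeff f n * (z : ℂ) ^ n) (inner ℂ (kernelVec c z) f) := by
  have h := lp.hasSum_inner (𝕜 := ℂ) (G := fun _ : ℕ => ℂ) (kernelVec c z).seq f.seq
  refine HasSum.congr_fun (f := _) h (fun n => ?_)
  simp [coeff, seq, kernelVec]
  ring

/-- Evaluation: an element of `DiscSpace c` as the function `z ↦ ∑ aₙ zⁿ` on the disc. -/
noncomputable def evalCLM (c : ℕ → ℝ) [IsDiscWeight c] : DiscSpace c →L[ℂ] (𝔻 → ℂ) :=
  ContinuousLinearMap.pi fun z => innerSL ℂ (kernelVec c z)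

theorem evalCLM_injective (c : ℕ → ℝ) [hc : IsDiscWeight c] :
    Function.Injective (evalCLM c : DiscSpace c → 𝔻 → ℂ) := by
  refine (injective_iff_map_eq_zero _).mpr fun f hf => ?_
  have h0 : ∀ z : 𝔻, HasSum (fun n : ℕ => coeff f n * (z : ℂ) ^ n) 0 := fun z => by
    have h1 := hasSum_inner_kernelVec c f z
    have h2 : (inner ℂ (kernelVec c z) f : ℂ) = 0 := congrFun hf z
    rwa [h2] at h1
  have hp : HasFPowerSeriesAt (fun _ : ℂ => (0 : ℂ))
      (FormalMultilinearSeries.ofScalars ℂ (coeff f)) 0 := by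
    rw [hasFPowerSeriesAt_iff]
    filter_upwards [Metric.ball_mem_nhds (0 : ℂ) one_pos] with z hz
    have h3 := h0 (Complex.UnitDisc.mk z (mem_ball_zero_iff.1 hz))
    simpa [FormalMultilinearSeries.coeff_ofScalars, mul_comm] using h3
  have hz := hp.eq_zero
  have hseq : seq f = 0 := by
    refine lp.ext (funext fun n => ?_)
    have h4 : coeff f n = 0 := by
      rw [← FormalMultilinearSeries.coeff_ofScalars (𝕜 := ℂ) (p := coeff f) (n := n), hz]
      rfl
    have h5 : (c n : ℂ) ≠ 0 := by exact_mod_cast (hc.pos n).ne'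
    simpa [coeff, h5] using h4
  exact hseq

/-- `DiscSpace c` is a reproducing kernel Hilbert space of functions on the unit disc. -/
noncomputable instance (c : ℕ → ℝ) [IsDiscWeight c] : RKHS ℂ (DiscSpace c) 𝔻 ℂ where
  coeCLM := evalCLM c
  coeCLM_injective := evalCLM_injective c

theorem hasSum_apply {c : ℕ → ℝ} [IsDiscWeight c] (f : DiscSpace c) (z : 𝔻) :
    HasSum (fun n : ℕ => coeff f n * (z : ℂ) ^ n) (f z) :=
  hasSum_inner_kernelVec c f z

theorem hasSum_norm_sq {c : ℕ → ℝ} [hc : IsDiscWeight c] (f : DiscSpace c) :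
    HasSum (fun n : ℕ => ‖coeff f n‖ ^ 2 / c n ^ 2) (‖f‖ ^ 2) := by
  have h := lp.hasSum_norm (p := 2) (by norm_num) f.seq
  norm_num at h
  refine HasSum.congr_fun (f := _) h (fun n => ?_)
  have h5 : c n ≠ 0 := (hc.pos n).ne'
  rw [coeff, norm_mul, mul_pow, Complex.norm_real, Real.norm_eq_abs, sq_abs]
  field_simp

theorem exists_of_coeff {c : ℕ → ℝ} [hc : IsDiscWeight c] (a : ℕ → ℂ)
    (ha : Summable fun n : ℕ => ‖a n‖ ^ 2 / c n ^ 2) : ∃ f : DiscSpace c, coeff f = a := by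
  have hm : Memℓp (fun n : ℕ => a n / (c n : ℂ)) 2 := by
    apply memℓp_gen
    refine ha.congr fun n => ?_
    rw [norm_div, Complex.norm_real, Real.norm_eq_abs]
    norm_num
    rw [div_pow, sq_abs]
  refine ⟨(⟨_, hm⟩ : lp (fun _ : ℕ => ℂ) 2), funext fun n => ?_⟩
  have h5 : (c n : ℂ) ≠ 0 := by exact_mod_cast (hc.pos n).ne'
  change (c n : ℂ) * (a n / (c n : ℂ)) = a n
  field_simp

/-- The reproducing kernel of `DiscSpace c` is `K(z, w) = ∑ cₙ² (w̄ z)ⁿ`. -/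
theorem hasSum_kernel (c : ℕ → ℝ) [IsDiscWeight c] (z w : 𝔻) :
    HasSum (fun n : ℕ => (c n : ℂ) ^ 2 * (conj (w : ℂ) * z) ^ n)
      (RKHS.kernel (DiscSpace c) z w 1) := by
  rw [← RKHS.kerFun_apply]
  have hk : RKHS.kerFun (DiscSpace c) w 1 = kernelVec c w := by
    refine ext_inner_right ℂ fun f => ?_
    rw [RKHS.kerFun_inner]
    rw [show (inner ℂ (1 : ℂ) (f w) : ℂ) = f w by simp]
    rfl
  rw [hk]
  refine HasSum.congr_fun (f := _) (hasSum_apply (kernelVec c w) z) (fun n => ?_)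
  simp [coeff, seq, kernelVec]
  ring

end DiscSpace

/-- The Hardy space `H²`: power series on the disc with `‖f‖² = ∑ |aₙ|² < ∞`. -/
abbrev HardySpace : Type := DiscSpace fun _ => 1

/-- The Dirichlet space: power series on the disc with `‖f‖² = ∑ (n + 1) |aₙ|² < ∞`. -/
abbrev DirichletSpace : Type := DiscSpace fun n => 1 / √((n : ℝ) + 1)

instance : IsDiscWeight (fun _ => 1) where
  pos _ := one_pos
  le_one _ := le_rfl

instance : IsDiscWeight (fun n => 1 / √((n : ℝ) + 1)) where
  pos n := by positivity
  le_one n := by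
    rw [div_le_one (by positivity), Real.one_le_sqrt]
    linarith [(Nat.cast_nonneg n : (0 : ℝ) ≤ n)]

theorem HardySpace.kernel_eq (z w : 𝔻) :
    RKHS.kernel HardySpace z w 1 = (1 - conj (w : ℂ) * z)⁻¹ := by
  have hlt : ‖conj (w : ℂ) * z‖ < 1 := by
    rw [norm_mul, RCLike.norm_conj]
    exact mul_lt_one_of_nonneg_of_lt_one_left (norm_nonneg _) w.norm_lt_one z.norm_lt_one.le
  refine (DiscSpace.hasSum_kernel _ z w).unique ?_
  simpa using hasSum_geometric_of_norm_lt_one hlt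

theorem DirichletSpace.kernel_eq (z w : 𝔻) (h : conj (w : ℂ) * z ≠ 0) :
    RKHS.kernel DirichletSpace z w 1 =
      1 / (conj (w : ℂ) * z) * Complex.log (1 / (1 - conj (w : ℂ) * z)) := by
  have hlt : ‖conj (w : ℂ) * z‖ < 1 := by
    rw [norm_mul, RCLike.norm_conj]
    exact mul_lt_one_of_nonneg_of_lt_one_left (norm_nonneg _) w.norm_lt_one z.norm_lt_one.le
  refine (DiscSpace.hasSum_kernel _ z w).unique ?_
  generalize conj (w : ℂ) * (z : ℂ) = u at h hlt
  have hre : 0 < (1 - u).re := by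
    have := (Complex.abs_re_le_norm u).trans_lt hlt
    rw [abs_lt] at this
    simp
    linarith
  have harg : (1 - u).arg ≠ Real.pi := by
    intro hπ
    have := (Complex.arg_eq_pi_iff.1 hπ).1
    linarith
  rw [one_div (1 - u), Complex.log_inv _ harg]
  have hs := (hasSum_nat_add_iff' 1).2 (Complex.hasSum_taylorSeries_neg_log hlt)
  simp only [Finset.range_one, Finset.sum_singleton, pow_zero, Nat.cast_zero, div_zero,
    sub_zero] at hs
  refine HasSum.congr_fun (f := _) (hs.mul_left (1 / u)) (fun n => ?_)
  have hn : (0 : ℝ) ≤ (n : ℝ) + 1 := by positivity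
  have hn' : (n : ℂ) + 1 ≠ 0 := Nat.cast_add_one_ne_zero n
  have hq : ((1 / √((n : ℝ) + 1) : ℝ) : ℂ) ^ 2 = 1 / ((n : ℂ) + 1) := by
    rw [← Complex.ofReal_pow, div_pow, Real.sq_sqrt hn]
    push_cast
    ring
  rw [hq]
  push_cast
  field_simp
  ring

/-- The functions on `X` that belong to the reproducing kernel Hilbert space `H`. -/
def functionsOf (H : Type*) {X : Type*} [NormedAddCommGroup H] [InnerProductSpace ℂ H]
    [RKHS ℂ H X ℂ] : Set (X → ℂ) :=
  Set.range fun f : H => (f : X → ℂ)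

/-- The multiplier algebra `M(H)`: the functions `m` on `X` such that multiplication by `m` is a
bounded linear map of `H` into itself. -/
def multipliers (H : Type*) {X : Type*} [NormedAddCommGroup H] [InnerProductSpace ℂ H]
    [RKHS ℂ H X ℂ] : Set (X → ℂ) :=
  {m | ∃ T : H →L[ℂ] H, ∀ (f : H) (x : X), T f x = m x * f x}

/-- `H^∞`: the bounded holomorphic functions on the unit disc. -/
def boundedHolomorphic : Set (𝔻 → ℂ) :=
  {m | (∃ F : ℂ → ℂ, DifferentiableOn ℂ F (Metric.ball 0 1) ∧ ∀ z : 𝔻, m z = F z) ∧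
    ∃ C : ℝ, ∀ z : 𝔻, ‖m z‖ ≤ C}

/-- `S` is a zero set for the class `A` of functions: some member of `A` vanishes at the points
of `S` and nowhere else. -/
def IsZeroSetFor {X : Type*} (A : Set (X → ℂ)) (S : Set X) : Prop :=
  ∃ f ∈ A, {x | f x = 0} = S

/-! Write `K(z, w) = ∑ κₙ (w̄ z)ⁿ` with `κₙ = cₙ²`. Both spaces have `κ₀ = 1` and log-convex `κ`, so
by Kaluza's lemma (`exists_isRenewal`) `1 - 1/K` is a power series `B` with coefficients `βₙ ≥ 0`
(the complete Pick property).

Fix `x ≠ 0` and put `r² = B(|x|²) = 1 - 1/K(x, x)`. Cauchy–Schwarz against the convolution identity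
for `β` shows that `B(x̄ z) / r` is a contractive multiplier
(`mem_contractiveMultipliers_of_norm_sq_le`). A disc automorphism turns it into `φₓ(z) = (1 - K(z,
x) / K(x, x)) / r`, still contractive. It vanishes only at `x`, provided `K` takes each of its
values on `[0, 1)` only once, and for fixed `z` it differs from `1` by `O(1 / K(x, x))`.

Contractive multipliers are closed under products and pointwise limits, so `∏ φₓ` is one as soon as
`∑ 1 / K(x, x) < ∞`, and an absolutely convergent product vanishes only where a factor does. A point
of `S` at the origin costs an extra factor `c₁ z`. Finally `1 / K(x, x)` is `1 - |x|²` for the Hardy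
space and at most `1 / log (1 / (1 - |x|²))` for the Dirichlet space. -/

open Filter Topology

/-! ### Contractive multipliers: automorphisms, limits and infinite products -/

section ContractiveMultipliers

variable {X : Type*}

/-- The functions on `X` that multiply the reproducing kernel Hilbert space `H` contractively into
itself. -/
def contractiveMultipliers (H : Type*) {X : Type*} [NormedAddCommGroup H] [InnerProductSpace ℂ H]
    [RKHS ℂ H X ℂ] : Set (X → ℂ) :=
  {m | ∀ f : H, ∃ h : H, ‖h‖ ≤ ‖f‖ ∧ ∀ x : X, h x = m x * f x}

variable {H : Type*} [NormedAddCommGroup H] [InnerProductSpace ℂ H] [RKHS ℂ H X ℂ]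

/-- Linearity is automatic: an element of `H` is determined by its values, and pointwise
multiplication is linear. -/
theorem exists_clm_of_mem_contractiveMultipliers {m : X → ℂ}
    (hm : m ∈ contractiveMultipliers H) :
    ∃ T : H →L[ℂ] H, ‖T‖ ≤ 1 ∧ ∀ (f : H) (x : X), T f x = m x * f x := by
  choose h hn hx using hm
  refine ⟨LinearMap.mkContinuous ⟨⟨h, fun f g => ?_⟩, fun a f => ?_⟩ 1 fun f => ?_,
    LinearMap.mkContinuous_norm_le _ zero_le_one _, fun f x => hx f x⟩
  · refine RKHS.ext fun x => ?_
    simp [hx, mul_add]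
  · refine RKHS.ext fun x => ?_
    simp [hx, mul_left_comm]
  · simpa using hn f

theorem contractiveMultipliers_subset_multipliers :
    contractiveMultipliers H ⊆ multipliers H := fun _ hm =>
  let ⟨T, _, hT⟩ := exists_clm_of_mem_contractiveMultipliers hm
  ⟨T, hT⟩

theorem one_mem_contractiveMultipliers : (1 : X → ℂ) ∈ contractiveMultipliers H :=
  fun f => ⟨f, le_rfl, fun x => by simp⟩

theorem mul_mem_contractiveMultipliers {m n : X → ℂ} (hm : m ∈ contractiveMultipliers H)
    (hn : n ∈ contractiveMultipliers H) : m * n ∈ contractiveMultipliers H := by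
  intro f
  obtain ⟨g, hg, hgx⟩ := hn f
  obtain ⟨h, hh, hhx⟩ := hm g
  exact ⟨h, hh.trans hg, fun x => by rw [hhx, hgx, Pi.mul_apply, mul_assoc]⟩

theorem prod_mem_contractiveMultipliers {ι : Type*} (s : Finset ι) {F : ι → X → ℂ}
    (hF : ∀ i, F i ∈ contractiveMultipliers H) : ∏ i ∈ s, F i ∈ contractiveMultipliers H :=
  Finset.prod_induction F (· ∈ contractiveMultipliers H)
    (fun _ _ => mul_mem_contractiveMultipliers) one_mem_contractiveMultipliers fun i _ => hF i

variable [CompleteSpace H]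

/-- Test on the kernel `k` at `x`: `|m x| ‖k‖² = |⟨k, m k⟩| ≤ ‖k‖²`. The function `f` only serves to
give `k ≠ 0`. -/
theorem norm_le_one_of_mem_contractiveMultipliers {m : X → ℂ}
    (hm : m ∈ contractiveMultipliers H) {x : X} {f : H} (hf : f x ≠ 0) : ‖m x‖ ≤ 1 := by
  set k : H := RKHS.kerFun H x 1 with hk
  have hrep : ∀ g : H, inner ℂ k g = g x := fun g => by simp [hk]
  have hk0 : 0 < ‖k‖ := by
    rw [norm_pos_iff]
    intro h0
    apply hf
    rw [← hrep, h0, inner_zero_left]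
  obtain ⟨h, hh, hx⟩ := hm k
  have hkx : ‖k x‖ = ‖k‖ ^ 2 := by
    rw [← hrep, inner_self_eq_norm_sq_to_K]
    simp
  have h1 : ‖m x‖ * ‖k‖ ^ 2 ≤ 1 * ‖k‖ ^ 2 := by
    rw [← hkx, ← norm_mul, ← hx x, ← hrep, hkx, one_mul, sq]
    exact (norm_inner_le_norm k h).trans (by gcongr)
  exact le_of_mul_le_mul_right h1 (by positivity)

/-- Disc automorphisms preserve contractive multipliers. -/
theorem moebius_mem_contractiveMultipliers {m : X → ℂ} (hm : m ∈ contractiveMultipliers H)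
    {r : ℝ} (hr0 : 0 ≤ r) (hr1 : r < 1) (hne : ∀ x, 1 - r * m x ≠ 0) :
    (fun x => (r - m x) / (1 - r * m x)) ∈ contractiveMultipliers H := by
  obtain ⟨T, hT, hTx⟩ := exists_clm_of_mem_contractiveMultipliers hm
  have hn : ‖(r : ℂ) • T‖ < 1 := by
    rw [norm_smul, Complex.norm_real, Real.norm_of_nonneg hr0]
    exact (mul_le_of_le_one_right hr0 hT).trans_lt hr1
  -- `V` is the inverse of `1 - rT`; with `g = V f`, the product of the new multiplier with `f` is
  -- `r g - T g`.
  obtain ⟨V, hV⟩ := (isUnit_one_sub_of_norm_lt_one hn).exists_right_inv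
  intro f
  have hf : f = V f - (r : ℂ) • T (V f) := by
    have := DFunLike.congr_fun hV f
    simpa using this.symm
  set g := V f
  refine ⟨(r : ℂ) • g - T g, ?_, fun x => ?_⟩
  · have hTg : ‖T g‖ ≤ ‖g‖ := (T.le_opNorm g).trans (mul_le_of_le_one_left (norm_nonneg _) hT)
    rw [← sq_le_sq₀ (norm_nonneg _) (norm_nonneg _), hf,
      @norm_sub_sq ℂ, @norm_sub_sq ℂ, inner_smul_left, inner_smul_right, norm_smul, norm_smul,
      Complex.norm_real, Real.norm_of_nonneg hr0, Complex.conj_ofReal]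
    have h2 : ‖T g‖ ^ 2 ≤ ‖g‖ ^ 2 := by gcongr
    have h3 : r ^ 2 ≤ 1 := pow_le_one₀ hr0 hr1.le
    -- `‖g - rTg‖² - ‖rg - Tg‖² = (1 - r²)(‖g‖² - ‖Tg‖²)`.
    nlinarith [mul_nonneg (sub_nonneg.2 h2) (sub_nonneg.2 h3)]
  · have hfx : f x = (1 - r * m x) * g x := by
      conv_lhs => rw [hf]
      rw [RKHS.coe_sub, Pi.sub_apply, RKHS.coe_smul, Pi.smul_apply, hTx, smul_eq_mul]
      ring
    rw [hfx, RKHS.coe_sub, Pi.sub_apply, RKHS.coe_smul, Pi.smul_apply, hTx, smul_eq_mul,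
      ← mul_assoc, div_mul_cancel₀ _ (hne x)]
    ring

/-- Pointwise limits of contractive multipliers are contractive multipliers. -/
theorem mem_contractiveMultipliers_of_tendsto {ι : Type*} {l : Filter ι} [l.NeBot]
    {F : ι → X → ℂ} {m : X → ℂ} (hF : ∀ i, F i ∈ contractiveMultipliers H)
    (hlim : ∀ x, Tendsto (fun i => F i x) l (𝓝 (m x))) : m ∈ contractiveMultipliers H := by
  intro f
  choose h hn hx using fun i => hF i f
  -- The products `F i * f` stay in the ball of radius `‖f‖`, which is weak-* compact, so they
  -- converge along an ultrafilter finer than `l`. The functional of `h i` sends the kernel at `x`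
  -- to `conj (h i x)`, hence the conjugates below.
  let Φ : ι → WeakDual ℂ H := fun i => StrongDual.toWeakDual (InnerProductSpace.toDual ℂ H (h i))
  obtain ⟨L, hL, hconv⟩ :=
    (WeakDual.isCompact_closedBall (0 : StrongDual ℂ H) ‖f‖).ultrafilter_le_nhds
      ((Ultrafilter.of l).map Φ) (by
        rw [Filter.le_principal_iff]
        refine Filter.Eventually.of_forall (f := (Ultrafilter.of l : Filter ι)) fun i => ?_
        simpa [Φ] using hn i)
  have hLn : ‖WeakDual.toStrongDual L‖ ≤ ‖f‖ := by simpa using hL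
  refine ⟨(InnerProductSpace.toDual ℂ H).symm (WeakDual.toStrongDual L), by simpa using hLn,
    fun x => ?_⟩
  set k : H := RKHS.kerFun H x 1 with hk
  have hrep : ∀ g : H, inner ℂ g k = conj (g x) := fun g => by simp [hk]
  have h1 : Tendsto (fun i => conj (h i x)) (Ultrafilter.of l) (𝓝 (L k)) := by
    have h2 : Tendsto Φ (Ultrafilter.of l) (𝓝 L) := hconv
    have h3 := ((WeakDual.eval_continuous k).tendsto L).comp h2
    refine h3.congr fun i => ?_
    rw [← hrep]
    rfl
  have h4 : Tendsto (fun i => conj (h i x)) (Ultrafilter.of l) (𝓝 (conj (m x * f x))) := by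
    simp_rw [hx]
    exact (Complex.continuous_conj.tendsto _).comp
      (((hlim x).mono_left (Ultrafilter.of_le l)).mul_const _)
  have h5 := tendsto_nhds_unique h1 h4
  apply (starRingEnd ℂ).injective
  rw [← h5, ← hrep, InnerProductSpace.toDual_symm_apply]
  rfl

/-- A product of contractive multipliers that converges absolutely is a contractive multiplier
whose zeros are those of the factors. -/
theorem exists_contractiveMultiplier_prod {ι : Type*} {F : ι → X → ℂ}
    (hF : ∀ i, F i ∈ contractiveMultipliers H) (hs : ∀ x, Summable fun i => ‖F i x - 1‖) :
    ∃ m ∈ contractiveMultipliers H, ∀ x, m x = 0 ↔ ∃ i, F i x = 0 := by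
  classical
  have hsplit : ∀ x i, F i x = 1 + (F i x - 1) := fun x i => by ring
  have hmul : ∀ x, Multipliable fun i => F i x := fun x => by
    exact (multipliable_one_add_of_summable (hs x)).congr fun i => (hsplit x i).symm
  refine ⟨fun x => ∏' i, F i x, mem_contractiveMultipliers_of_tendsto (l := atTop)
    (F := fun s : Finset ι => ∏ i ∈ s, F i) (fun s => prod_mem_contractiveMultipliers s hF)
    (fun x => ?_), fun x => ⟨fun h => ?_, fun ⟨i, hi⟩ => ?_⟩⟩
  · have : Tendsto (fun s : Finset ι => ∏ i ∈ s, F i x) atTop (𝓝 (∏' i, F i x)) :=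
      (hmul x).hasProd
    simpa [Finset.prod_apply] using this
  · by_contra! hne
    refine tprod_one_add_ne_zero_of_summable (f := fun i => F i x - 1) (fun i => ?_) (hs x) ?_
    · simpa using hne i
    · simpa using h
  · exact tprod_of_exists_eq_zero ⟨i, hi⟩

end ContractiveMultipliers

/-! ### Kaluza's lemma and the power series `1 - 1/K` -/

section Kaluza

open Finset

/-- `β` are the coefficients of `1 - 1/K`, where `K(u) = ∑ κₙ uⁿ` has `κ₀ = 1`. -/
structure IsRenewal (κ β : ℕ → ℝ) : Prop where
  zero : κ 0 = 1
  apply_zero : β 0 = 0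
  nonneg : ∀ n, 0 ≤ β n
  sum_antidiagonal : ∀ n, ∑ p ∈ antidiagonal (n + 1), β p.1 * κ p.2 = κ (n + 1)

/-- Log-convexity says that the ratios `κ (n + 1) / κ n` increase; this compares the ratios at `j`
and `j + d`. -/
theorem mul_le_mul_of_sq_le {κ : ℕ → ℝ} (hpos : ∀ n, 0 < κ n)
    (hlog : ∀ n, κ (n + 1) ^ 2 ≤ κ n * κ (n + 2)) (j d : ℕ) :
    κ (j + 1) * κ (j + d) ≤ κ j * κ (j + d + 1) := by
  induction d with
  | zero => rw [add_zero, mul_comm]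
  | succ d ih =>
    have h1 := hlog (j + d)
    have h2 := hpos (j + d)
    have h3 := hpos (j + d + 1)
    refine le_of_mul_le_mul_right ?_ (mul_pos h2 h3)
    calc κ (j + 1) * κ (j + (d + 1)) * (κ (j + d) * κ (j + d + 1))
        = (κ (j + 1) * κ (j + d)) * κ (j + d + 1) ^ 2 := by ring_nf
      _ ≤ (κ j * κ (j + d + 1)) * (κ (j + d) * κ (j + d + 2)) :=
          mul_le_mul ih h1 (by positivity) (mul_pos (hpos _) h3).le
      _ = κ j * κ (j + (d + 1) + 1) * (κ (j + d) * κ (j + d + 1)) := by ring_nf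

/-- Kaluza's lemma: if `κ` is log-convex then `1 - 1/K` has nonnegative coefficients. -/
theorem exists_isRenewal {κ : ℕ → ℝ} (hpos : ∀ n, 0 < κ n) (h0 : κ 0 = 1)
    (hlog : ∀ n, κ (n + 1) ^ 2 ≤ κ n * κ (n + 2)) : ∃ β, IsRenewal κ β := by
  let P : PowerSeries ℝ := PowerSeries.mk κ
  have hP : P⁻¹ * P = 1 := PowerSeries.inv_mul_cancel _ (by simp [P, h0])
  let Q : PowerSeries ℝ := 1 - P⁻¹
  have hQP : Q * P = P - 1 := by simp [Q, sub_mul, hP]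
  have hsum : ∀ n, ∑ p ∈ antidiagonal (n + 1), PowerSeries.coeff p.1 Q * κ p.2 = κ (n + 1) := by
    intro n
    have := congrArg (PowerSeries.coeff (n + 1)) hQP
    rw [PowerSeries.coeff_mul] at this
    simpa [P, PowerSeries.coeff_one] using this
  have hQ0 : PowerSeries.coeff 0 Q = 0 := by simp [Q, P, h0]
  refine ⟨fun n => PowerSeries.coeff n Q, h0, hQ0, fun n => ?_, hsum⟩
  induction n using Nat.strong_induction_on with
  | _ n ih =>
  cases n with
  | zero => exact hQ0.ge
  | succ n =>
    -- As `κ 0 = 1`, the new coefficient is `κ (n + 1) - ∑ β j κ (n + 1 - j)` over `j ≤ n`. Monotone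
    -- ratios bound this sum by `(κ (n + 1) / κ n) ∑ β j κ (n - j) ≤ κ (n + 1)`.
    have h1 := hsum n
    rw [Nat.sum_antidiagonal_succ', h0, mul_one] at h1
    have h2 : ∑ p ∈ antidiagonal n, PowerSeries.coeff p.1 Q * κ p.2 ≤ κ n := by
      cases n with
      | zero => simp [hQ0, h0]
      | succ n => exact (hsum n).le
    have h3 : (∑ p ∈ antidiagonal n, PowerSeries.coeff p.1 Q * κ (p.2 + 1)) * κ n ≤
        (∑ p ∈ antidiagonal n, PowerSeries.coeff p.1 Q * κ p.2) * κ (n + 1) := by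
      rw [sum_mul, sum_mul]
      refine sum_le_sum fun p hp => ?_
      have hp' : p.2 + p.1 = n := by rw [add_comm]; exact mem_antidiagonal.1 hp
      have h4 := mul_le_mul_of_sq_le hpos hlog p.2 p.1
      rw [hp'] at h4
      rw [mul_assoc, mul_assoc]
      exact mul_le_mul_of_nonneg_left h4 (ih _ (by omega))
    have h5 : (∑ p ∈ antidiagonal n, PowerSeries.coeff p.1 Q * κ (p.2 + 1)) * κ n ≤
        κ (n + 1) * κ n :=
      h3.trans (by rw [mul_comm]; exact mul_le_mul_of_nonneg_left h2 (hpos _).le)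
    have h6 := le_of_mul_le_mul_right h5 (hpos n)
    linarith

namespace IsRenewal

variable {κ β : ℕ → ℝ}

/-- Equality holds except at `n = 0`, where the sum is `0` and `κ 0 = 1`. -/
theorem sum_antidiagonal_le (h : IsRenewal κ β) (n : ℕ) :
    ∑ p ∈ antidiagonal n, β p.1 * κ p.2 ≤ κ n := by
  cases n with
  | zero => simp [h.apply_zero, h.zero]
  | succ n => exact (h.sum_antidiagonal n).le

theorem le (h : IsRenewal κ β) (hpos : ∀ n, 0 < κ n) (n : ℕ) : β n ≤ κ n := by
  refine le_trans ?_ (h.sum_antidiagonal_le n)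
  have := single_le_sum (f := fun p : ℕ × ℕ => β p.1 * κ p.2)
    (fun p _ => mul_nonneg (h.nonneg p.1) (hpos p.2).le)
    (show (n, 0) ∈ antidiagonal n by simp)
  simpa [h.zero] using this

theorem apply_one (h : IsRenewal κ β) : β 1 = κ 1 := by
  have := h.sum_antidiagonal 0
  simpa [Nat.sum_antidiagonal_succ, h.apply_zero, h.zero] using this

end IsRenewal

theorem summable_norm_coeff_mul_pow {a : ℕ → ℝ} (h0 : ∀ n, 0 ≤ a n) (h1 : ∀ n, a n ≤ 1) {u : ℂ}
    (hu : ‖u‖ < 1) : Summable fun n => ‖(a n : ℂ) * u ^ n‖ := by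
  refine (summable_geometric_of_lt_one (norm_nonneg u) hu).of_nonneg_of_le
    (fun n => norm_nonneg _) fun n => ?_
  rw [norm_mul, norm_pow, Complex.norm_real, Real.norm_of_nonneg (h0 n)]
  exact mul_le_of_le_one_left (by positivity) (h1 n)

theorem norm_tsum_coeff_mul_pow_le {a : ℕ → ℝ} (h0 : ∀ n, 0 ≤ a n) (h1 : ∀ n, a n ≤ 1) {u : ℂ}
    (hu : ‖u‖ < 1) : ‖∑' n, (a n : ℂ) * u ^ n‖ ≤ (1 - ‖u‖)⁻¹ := by
  refine (norm_tsum_le_tsum_norm (summable_norm_coeff_mul_pow h0 h1 hu)).trans ?_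
  rw [← tsum_geometric_of_lt_one (norm_nonneg u) hu]
  refine (summable_norm_coeff_mul_pow h0 h1 hu).tsum_le_tsum (fun n => ?_)
    (summable_geometric_of_lt_one (norm_nonneg u) hu)
  rw [norm_mul, norm_pow, Complex.norm_real, Real.norm_of_nonneg (h0 n)]
  exact mul_le_of_le_one_left (by positivity) (h1 n)

/-- The convolution identity reads `B K = K - 1`. Both coefficient sequences lie in `[0, 1]`, so the
series converge absolutely on the disc and the Cauchy product applies. -/
theorem IsRenewal.tsum_mul_one_sub_tsum {κ β : ℕ → ℝ} (h : IsRenewal κ β) (hpos : ∀ n, 0 < κ n)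
    (hle : ∀ n, κ n ≤ 1) {u : ℂ} (hu : ‖u‖ < 1) :
    (∑' n, (κ n : ℂ) * u ^ n) * (1 - ∑' n, (β n : ℂ) * u ^ n) = 1 := by
  have hκ := summable_norm_coeff_mul_pow (fun n => (hpos n).le) hle hu
  have hβ := summable_norm_coeff_mul_pow h.nonneg (fun n => (h.le hpos n).trans (hle n)) hu
  have hmul := tsum_mul_tsum_eq_tsum_sum_antidiagonal_of_summable_norm hβ hκ
  have hc : ∀ n, ∑ p ∈ antidiagonal n, (β p.1 : ℂ) * u ^ p.1 * ((κ p.2 : ℂ) * u ^ p.2) =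
      ((∑ p ∈ antidiagonal n, β p.1 * κ p.2 : ℝ) : ℂ) * u ^ n := by
    intro n
    push_cast
    rw [sum_mul]
    refine sum_congr rfl fun p hp => ?_
    rw [← mem_antidiagonal.1 hp, pow_add]
    ring
  simp_rw [hc] at hmul
  have h1 : HasSum (fun n => ((∑ p ∈ antidiagonal (n + 1), β p.1 * κ p.2 : ℝ) : ℂ) * u ^ (n + 1))
      ((∑' n, (κ n : ℂ) * u ^ n) - 1) := by
    have h2 := (hasSum_nat_add_iff' 1).2 hκ.of_norm.hasSum
    simp only [range_one, sum_singleton, h.zero, pow_zero, Complex.ofReal_one, mul_one] at h2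
    simpa only [h.sum_antidiagonal] using h2
  have h3 := (hasSum_nat_add_iff (f := fun n =>
    ((∑ p ∈ antidiagonal n, β p.1 * κ p.2 : ℝ) : ℂ) * u ^ n) 1).1 h1
  simp only [range_one, sum_singleton, Nat.antidiagonal_zero, h.apply_zero, zero_mul,
    Complex.ofReal_zero, add_zero] at h3
  rw [h3.tsum_eq] at hmul
  linear_combination -hmul

end Kaluza

/-! ### A coefficient criterion for contractive multipliers -/

namespace DiscSpace

open Finset

variable {c : ℕ → ℝ} [hc : IsDiscWeight c]

/-- A power series is a contractive multiplier if its coefficients are dominated by those of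
`1 - 1/K`. -/
theorem mem_contractiveMultipliers_of_norm_sq_le {β δ : ℕ → ℝ} {γ : ℕ → ℂ} {S : ℝ} {g : 𝔻 → ℂ}
    (hβ : IsRenewal (fun n => c n ^ 2) β) (hδ0 : ∀ n, 0 ≤ δ n) (hδ : HasSum δ S) (hS : S ≤ 1)
    (hγ : ∀ n, ‖γ n‖ ^ 2 ≤ β n * δ n) (hg : ∀ z : 𝔻, HasSum (fun n => γ n * (z : ℂ) ^ n) (g z)) :
    g ∈ contractiveMultipliers (DiscSpace c) := by
  intro f
  set a := coeff f with ha
  have hfs := hasSum_norm_sq f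
  let e : ℕ → ℝ := fun n => ‖a n‖ ^ 2 / c n ^ 2
  have he0 : ∀ n, 0 ≤ e n := fun n => by positivity
  have hpos : ∀ n, 0 < c n ^ 2 := fun n => pow_pos (hc.pos n) 2
  -- `b` holds the coefficients of `g f`; `d` will dominate the terms of its squared norm and sums
  -- to `S ‖f‖²`.
  let b : ℕ → ℂ := fun n => ∑ p ∈ antidiagonal n, γ p.1 * a p.2
  let d : ℕ → ℝ := fun n => ∑ p ∈ antidiagonal n, δ p.1 * e p.2
  have hd : HasSum d (S * ‖f‖ ^ 2) := by
    have h1 : Summable fun n => ‖δ n‖ := hδ.summable.norm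
    have h2 : Summable fun n => ‖e n‖ := hfs.summable.norm
    have h3 := tsum_mul_tsum_eq_tsum_sum_antidiagonal_of_summable_norm h1 h2
    have h4 : ∑' n, e n = ‖f‖ ^ 2 := hfs.tsum_eq
    rw [hδ.tsum_eq, h4] at h3
    rw [h3]
    exact (summable_norm_sum_mul_antidiagonal_of_summable_norm h1 h2).of_norm.hasSum
  have hb : ∀ n, ‖b n‖ ^ 2 / c n ^ 2 ≤ d n := by
    intro n
    rw [div_le_iff₀ (hpos n)]
    have h1 : ‖b n‖ ≤ ∑ p ∈ antidiagonal n, ‖γ p.1‖ * ‖a p.2‖ :=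
      (norm_sum_le _ _).trans_eq (sum_congr rfl fun p _ => norm_mul _ _)
    -- Cauchy–Schwarz with weights `β c²` and `δ e`; the first factor is then at most `c n ^ 2` by
    -- the convolution identity.
    have h2 : (∑ p ∈ antidiagonal n, ‖γ p.1‖ * ‖a p.2‖) ^ 2 ≤
        (∑ p ∈ antidiagonal n, β p.1 * c p.2 ^ 2) * ∑ p ∈ antidiagonal n, δ p.1 * e p.2 := by
      refine sum_sq_le_sum_mul_sum_of_sq_le_mul _
        (fun p _ => mul_nonneg (hβ.nonneg _) (hpos _).le)
        (fun p _ => mul_nonneg (hδ0 _) (he0 _)) fun p _ => ?_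
      have h3 : c p.2 ^ 2 * e p.2 = ‖a p.2‖ ^ 2 := mul_div_cancel₀ _ (hpos _).ne'
      calc (‖γ p.1‖ * ‖a p.2‖) ^ 2 = ‖γ p.1‖ ^ 2 * ‖a p.2‖ ^ 2 := mul_pow _ _ _
        _ ≤ β p.1 * δ p.1 * ‖a p.2‖ ^ 2 := by gcongr; exact hγ _
        _ = _ := by rw [← h3]; ring
    have hd0 : 0 ≤ d n := sum_nonneg fun p _ => mul_nonneg (hδ0 _) (he0 _)
    calc ‖b n‖ ^ 2 ≤ (∑ p ∈ antidiagonal n, ‖γ p.1‖ * ‖a p.2‖) ^ 2 := by gcongr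
      _ ≤ _ := h2
      _ ≤ c n ^ 2 * d n := mul_le_mul_of_nonneg_right (hβ.sum_antidiagonal_le n) hd0
      _ = d n * c n ^ 2 := mul_comm _ _
  obtain ⟨h, hh⟩ := exists_of_coeff (c := c) b
    (hd.summable.of_nonneg_of_le (fun n => by positivity) hb)
  refine ⟨h, ?_, fun z => ?_⟩
  · rw [← sq_le_sq₀ (norm_nonneg _) (norm_nonneg _)]
    have h1 := hasSum_norm_sq h
    rw [hh] at h1
    exact (hasSum_le hb h1 hd).trans (mul_le_of_le_one_left (by positivity) hS)
  · have h1 := hasSum_apply f z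
    have h2 := tsum_mul_tsum_eq_tsum_sum_antidiagonal_of_summable_norm
      (hg z).summable.norm h1.summable.norm
    rw [(hg z).tsum_eq, h1.tsum_eq] at h2
    rw [h2, ← (hasSum_apply h z).tsum_eq, hh]
    refine tsum_congr fun n => ?_
    rw [sum_mul]
    refine sum_congr rfl fun p hp => ?_
    rw [← mem_antidiagonal.1 hp, pow_add]
    ring

end DiscSpace

/-! ### Multipliers with one zero, and their product -/

namespace DiscSpace

open Finset

variable {c : ℕ → ℝ} [hc : IsDiscWeight c]

theorem norm_conj_mul_lt_one (x z : 𝔻) : ‖conj (x : ℂ) * z‖ < 1 := by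
  rw [norm_mul, RCLike.norm_conj]
  exact mul_lt_one_of_nonneg_of_lt_one_left (norm_nonneg _) x.norm_lt_one z.norm_lt_one.le

theorem norm_conj_mul_le (x z : 𝔻) : ‖conj (x : ℂ) * z‖ ≤ ‖(z : ℂ)‖ := by
  rw [norm_mul, RCLike.norm_conj]
  exact mul_le_of_le_one_left (norm_nonneg _) x.norm_lt_one.le

/-- The function `(1 - K(z, x) / K(x, x)) / √(1 - 1 / K(x, x))` is a contractive multiplier. -/
theorem one_sub_kernel_div_mem_contractiveMultipliers
    (h0 : c 0 = 1) (hlog : ∀ n, (c (n + 1) ^ 2) ^ 2 ≤ c n ^ 2 * c (n + 2) ^ 2)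
    {x : 𝔻} (hx : x ≠ 0) {k : ℝ}
    (hk : k = ∑' n, c n ^ 2 * (‖(x : ℂ)‖ ^ 2) ^ n) :
    1 < k ∧ (fun z : 𝔻 => (1 - (∑' n, (c n : ℂ) ^ 2 * (conj (x : ℂ) * z) ^ n) / k) /
      (√(1 - k⁻¹) : ℝ)) ∈ contractiveMultipliers (DiscSpace c) := by
  have hpos : ∀ n, 0 < c n ^ 2 := fun n => pow_pos (hc.pos n) 2
  have hle : ∀ n, c n ^ 2 ≤ 1 := fun n => pow_le_one₀ (hc.pos n).le (hc.le_one n)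
  obtain ⟨β, hβ⟩ := exists_isRenewal hpos (by simp [h0]) hlog
  have hβ1 : ∀ n, β n ≤ 1 := fun n => (hβ.le hpos n).trans (hle n)
  set t : ℝ := ‖(x : ℂ)‖ ^ 2 with ht
  have ht0 : 0 < t := pow_pos (norm_pos_iff.2 (by simpa using hx)) 2
  have ht1 : t < 1 := x.sq_norm_lt_one
  have hβs : Summable fun n => β n * t ^ n :=
    (summable_geometric_of_lt_one ht0.le ht1).of_nonneg_of_le
      (fun n => mul_nonneg (hβ.nonneg n) (by positivity))
      fun n => mul_le_of_le_one_left (by positivity) (hβ1 n)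
  set R : ℝ := ∑' n, β n * t ^ n with hR
  have hkR : k * (1 - R) = 1 := by
    have h1 := hβ.tsum_mul_one_sub_tsum hpos hle (u := (t : ℂ))
      (by rwa [Complex.norm_real, Real.norm_of_nonneg ht0.le])
    rw [hk]
    exact_mod_cast h1
  -- The term `n = 1` is already positive, because `β 1 = c 1 ^ 2` and `x ≠ 0`.
  have hR0 : 0 < R := by
    refine lt_of_lt_of_le ?_ (hβs.le_tsum 1
      fun n _ => mul_nonneg (hβ.nonneg n) (by positivity))
    rw [hβ.apply_one]
    exact mul_pos (hpos 1) (by positivity)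
  have hk0 : 0 ≤ k := by
    rw [hk]
    exact tsum_nonneg fun n => mul_nonneg (hpos n).le (by positivity)
  have hk1 : 1 < k := by
    have := mul_pos (hk0.lt_of_ne' (left_ne_zero_of_mul_eq_one hkR)) hR0
    linarith
  have hk' : k ≠ 0 := by linarith
  have hRk : 1 - k⁻¹ = R := by
    field_simp
    linarith
  have hR1 : R < 1 := by
    rw [← hRk]
    linarith [inv_pos.2 (zero_lt_one.trans hk1)]
  refine ⟨hk1, ?_⟩
  rw [hRk]
  set r : ℝ := √R with hr
  have hr0 : 0 < r := Real.sqrt_pos.2 hR0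
  have hrR : r ^ 2 = R := Real.sq_sqrt hR0.le
  have hr1 : r < 1 := by
    rw [hr, Real.sqrt_lt' one_pos]
    simpa using hR1
  have hr' : (r : ℂ) ≠ 0 := by exact_mod_cast hr0.ne'
  let B : 𝔻 → ℂ := fun z => ∑' n, (β n : ℂ) * (conj (x : ℂ) * z) ^ n
  have hBs (z : 𝔻) : HasSum (fun n => (β n : ℂ) * (conj (x : ℂ) * z) ^ n) (B z) :=
    (summable_norm_coeff_mul_pow hβ.nonneg hβ1 (norm_conj_mul_lt_one x z)).of_norm.hasSum
  have hg : (fun z => B z / r) ∈ contractiveMultipliers (DiscSpace c) := by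
    -- Dividing by `R` gives `δ` total mass `1`, and `‖γ n‖ ^ 2 = β n * δ n` because `r ^ 2 = R`.
    refine mem_contractiveMultipliers_of_norm_sq_le (β := β) (δ := fun n => β n * t ^ n / R)
      (γ := fun n => β n * conj (x : ℂ) ^ n / r) (S := 1) hβ
      (fun n => div_nonneg (mul_nonneg (hβ.nonneg n) (by positivity)) hR0.le) ?_ le_rfl
      (fun n => ?_) (fun z => ?_)
    · have := hβs.hasSum.div_const R
      rwa [← hR, div_self hR0.ne'] at this
    · rw [norm_div, norm_mul, norm_pow, RCLike.norm_conj, Complex.norm_real, Complex.norm_real,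
        Real.norm_of_nonneg (hβ.nonneg n), Real.norm_of_nonneg hr0.le, div_pow, hrR, ht, mul_pow,
        ← pow_mul, ← pow_mul, mul_comm n 2]
      exact le_of_eq (by ring)
    · refine HasSum.congr_fun (f := _) ((hBs z).div_const (r : ℂ)) fun n => ?_
      ring
  have hKB (z : 𝔻) : (∑' n, (c n : ℂ) ^ 2 * (conj (x : ℂ) * z) ^ n) * (1 - B z) = 1 := by
    simpa using hβ.tsum_mul_one_sub_tsum hpos hle (norm_conj_mul_lt_one x z)
  have hB1 : ∀ z, 1 - B z ≠ 0 := fun z => right_ne_zero_of_mul_eq_one (hKB z)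
  -- The automorphism gives `(r - B/r) / (1 - B)`, which equals `(1 - K/k) / r` since `1 - B = 1/K`
  -- and `1 - r² = 1/k`.
  have hm := moebius_mem_contractiveMultipliers hg hr0.le hr1 (fun z => by
    rw [mul_div_cancel₀ _ hr']
    exact hB1 z)
  convert hm using 2 with z
  have hK : (∑' n, (c n : ℂ) ^ 2 * (conj (x : ℂ) * z) ^ n) = (1 - B z)⁻¹ :=
    eq_inv_of_mul_eq_one_left (hKB z)
  have hkc : (k : ℂ)⁻¹ = 1 - (r : ℂ) ^ 2 := by
    rw [← Complex.ofReal_pow, hrR, ← hRk]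
    push_cast
    ring
  have := hB1 z
  rw [hK, mul_div_cancel₀ _ hr', div_eq_mul_inv _ (k : ℂ), hkc]
  field_simp
  ring

/-- For `x ≠ 0` there is a contractive multiplier that vanishes exactly at `x` and that is close
to `1` when `K(x, x)` is large. -/
theorem exists_contractiveMultiplier_eq_zero_iff
    (h0 : c 0 = 1) (hlog : ∀ n, (c (n + 1) ^ 2) ^ 2 ≤ c n ^ 2 * c (n + 2) ^ 2)
    (hinj : ∀ (u : ℂ) (t : ℝ), ‖u‖ < 1 → 0 ≤ t → t < 1 →
      ∑' n, (c n : ℂ) ^ 2 * u ^ n = ∑' n, (c n : ℂ) ^ 2 * (t : ℂ) ^ n → u = t)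
    {x : 𝔻} (hx : x ≠ 0) :
    ∃ φ ∈ contractiveMultipliers (DiscSpace c), (∀ z, φ z = 0 ↔ z = x) ∧
      ∀ z : 𝔻, (∑' n, c n ^ 2 * (‖(x : ℂ)‖ ^ 2) ^ n)⁻¹ ≤ 1 / 2 →
        ‖φ z - 1‖ ≤ 2 * (1 + (1 - ‖(z : ℂ)‖)⁻¹) * (∑' n, c n ^ 2 * (‖(x : ℂ)‖ ^ 2) ^ n)⁻¹ := by
  set k : ℝ := ∑' n, c n ^ 2 * (‖(x : ℂ)‖ ^ 2) ^ n with hk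
  have hpos : ∀ n, 0 < c n ^ 2 := fun n => pow_pos (hc.pos n) 2
  have hle : ∀ n, c n ^ 2 ≤ 1 := fun n => pow_le_one₀ (hc.pos n).le (hc.le_one n)
  obtain ⟨hk1, hφ⟩ := one_sub_kernel_div_mem_contractiveMultipliers h0 hlog hx hk
  have hk0 : 0 < k := zero_lt_one.trans hk1
  have hkc : (k : ℂ) ≠ 0 := by exact_mod_cast hk0.ne'
  have hi0 : 0 < k⁻¹ := inv_pos.2 hk0
  have hi1 : k⁻¹ < 1 := inv_lt_one_of_one_lt₀ hk1
  set r : ℝ := √(1 - k⁻¹) with hr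
  have hr0 : 0 < r := Real.sqrt_pos.2 (by linarith)
  have hrR : r ^ 2 = 1 - k⁻¹ := Real.sq_sqrt (by linarith)
  have hr1 : r ≤ 1 := by nlinarith
  have hr' : (r : ℂ) ≠ 0 := by exact_mod_cast hr0.ne'
  have hxt : conj (x : ℂ) * x = ((‖(x : ℂ)‖ ^ 2 : ℝ) : ℂ) := by
    rw [mul_comm, Complex.mul_conj, Complex.normSq_eq_norm_sq]
  have hkx : (k : ℂ) = ∑' n, (c n : ℂ) ^ 2 * ((‖(x : ℂ)‖ ^ 2 : ℝ) : ℂ) ^ n := by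
    rw [hk]
    push_cast
    rfl
  refine ⟨_, hφ, fun z => ?_, fun z hz => ?_⟩
  · rw [div_eq_zero_iff, or_iff_left hr', sub_eq_zero, eq_comm, div_eq_one_iff_eq hkc, hkx]
    constructor
    · intro h
      have h1 := hinj _ _ (norm_conj_mul_lt_one x z) (by positivity) x.sq_norm_lt_one h
      rw [← hxt] at h1
      have hx' : conj (x : ℂ) ≠ 0 := by simpa using hx
      exact_mod_cast mul_left_cancel₀ hx' h1
    · rintro rfl
      rw [hxt]
  · have hK : ‖∑' n, (c n : ℂ) ^ 2 * (conj (x : ℂ) * z) ^ n‖ ≤ (1 - ‖(z : ℂ)‖)⁻¹ := by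
      have h1 := norm_tsum_coeff_mul_pow_le (fun n => (hpos n).le) hle (norm_conj_mul_lt_one x z)
      push_cast at h1
      refine h1.trans (inv_anti₀ (by linarith [z.norm_lt_one]) ?_)
      linarith [norm_conj_mul_le x z]
    set K := ∑' n, (c n : ℂ) ^ 2 * (conj (x : ℂ) * z) ^ n
    -- From `r² = 1 - 1/k ≥ 1/2`; dividing by `r` then costs at most the factor `2`.
    have hrhalf : 1 / 2 ≤ r := by nlinarith
    have heq : (1 - K / k) / r - 1 = ((1 - r : ℝ) - K * (k⁻¹ : ℝ)) / r := by
      push_cast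
      field_simp
      ring
    rw [heq, norm_div, Complex.norm_real, Real.norm_of_nonneg hr0.le, div_le_iff₀ hr0]
    have h2 : ‖((1 - r : ℝ) : ℂ) - K * (k⁻¹ : ℝ)‖ ≤ (1 + (1 - ‖(z : ℂ)‖)⁻¹) * k⁻¹ := by
      refine (norm_sub_le _ _).trans ?_
      rw [norm_mul, Complex.norm_real, Complex.norm_real, Real.norm_of_nonneg hi0.le,
        Real.norm_of_nonneg (by linarith), add_mul, one_mul]
      -- Since `0 < r ≤ 1`, one has `1 - r ≤ 1 - r² = 1/k`.
      refine add_le_add (by nlinarith) (by gcongr)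
    have h3 : 0 ≤ (1 + (1 - ‖(z : ℂ)‖)⁻¹) * k⁻¹ :=
      mul_nonneg (add_nonneg zero_le_one (inv_nonneg.2 (by linarith [z.norm_lt_one]))) hi0.le
    nlinarith

/-- A set with `∑ 1 / K(x, x) < ∞` is a zero set for the contractive multipliers. -/
theorem isZeroSetFor_contractiveMultipliers
    (h0 : c 0 = 1) (hlog : ∀ n, (c (n + 1) ^ 2) ^ 2 ≤ c n ^ 2 * c (n + 2) ^ 2)
    (hinj : ∀ (u : ℂ) (t : ℝ), ‖u‖ < 1 → 0 ≤ t → t < 1 →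
      ∑' n, (c n : ℂ) ^ 2 * u ^ n = ∑' n, (c n : ℂ) ^ 2 * (t : ℂ) ^ n → u = t)
    {S : Set 𝔻} (hS : Summable fun x : (S \ {0} : Set 𝔻) =>
      (∑' n, c n ^ 2 * (‖((x : 𝔻) : ℂ)‖ ^ 2) ^ n)⁻¹) :
    IsZeroSetFor (contractiveMultipliers (DiscSpace c)) S := by
  have hpos : ∀ n, 0 < c n ^ 2 := fun n => pow_pos (hc.pos n) 2
  choose φ hφ hφ0 hφ1 using fun x : (S \ {0} : Set 𝔻) =>
    exists_contractiveMultiplier_eq_zero_iff h0 hlog hinj (x := x) x.2.2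
  obtain ⟨m, hm, hm0⟩ := exists_contractiveMultiplier_prod hφ fun z => by
    refine Summable.of_norm_bounded_eventually (hS.mul_left (2 * (1 + (1 - ‖(z : ℂ)‖)⁻¹))) ?_
    -- Summability forces `1 / K(x, x) ≤ 1/2` for all but finitely many `x`, which is enough for
    -- convergence.
    filter_upwards [hS.tendsto_cofinite_zero.eventually_le_const one_half_pos] with x hx
    rw [norm_norm]
    exact hφ1 x z hx
  have hm1 : ∀ z, m z = 0 ↔ z ∈ S \ {0} := fun z => by
    rw [hm0]
    exact ⟨fun ⟨x, hx⟩ => (hφ0 x z).1 hx ▸ x.2, fun hz => ⟨⟨z, hz⟩, (hφ0 _ z).2 rfl⟩⟩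
  by_cases hS0 : (0 : 𝔻) ∈ S
  · obtain ⟨β, hβ⟩ := exists_isRenewal hpos (by simp [h0]) hlog
    have hc1 : (c 1 : ℂ) ≠ 0 := by exact_mod_cast (hc.pos 1).ne'
    -- At the origin `K(0, 0) = 1`, so the kernel construction degenerates to `0/0`. The factor `c₁
    -- z` replaces it; it meets the criterion because `c₁² = β₁`.
    have hz : (fun z : 𝔻 => (c 1 : ℂ) * z) ∈ contractiveMultipliers (DiscSpace c) := by
      refine mem_contractiveMultipliers_of_norm_sq_le (β := β) (δ := Pi.single 1 1)
        (γ := Pi.single 1 (c 1 : ℂ)) (S := 1) hβ (fun n => ?_) (hasSum_pi_single 1 1) le_rfl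
        (fun n => ?_) (fun z => ?_)
      · by_cases hn : n = 1 <;> simp [hn]
      · by_cases hn : n = 1 <;> simp [hn, hβ.apply_one]
      · refine HasSum.congr_fun (f := _) (hasSum_pi_single 1 ((c 1 : ℂ) * z)) fun n => ?_
        by_cases hn : n = 1 <;> simp [hn]
    refine ⟨_, mul_mem_contractiveMultipliers hz hm, Set.ext fun z => ?_⟩
    by_cases hz0 : z = 0
    · simp [hz0, hS0]
    · simp [hm1, hc1, hz0]
  · refine ⟨m, hm, Set.ext fun z => ?_⟩
    rw [Set.mem_ofPred_eq, hm1, Set.sdiff_singleton_eq_self hS0]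

end DiscSpace

/-! ### From contractive multipliers to the classes of the theorem -/

namespace DiscSpace

variable {c : ℕ → ℝ} [hc : IsDiscWeight c]

/-- The constant function `1` as an element of the space. -/
theorem exists_apply_eq_one (c : ℕ → ℝ) [hc : IsDiscWeight c] :
    ∃ f : DiscSpace c, ∀ z, f z = 1 := by
  obtain ⟨f, hf⟩ := exists_of_coeff (c := c) (Pi.single 0 1) <| by
    refine (hasSum_pi_single 0 (1 / c 0 ^ 2)).summable.congr fun n => ?_
    by_cases hn : n = 0 <;> simp [hn]
  refine ⟨f, fun z => (hasSum_apply f z).unique ?_⟩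
  rw [hf]
  refine HasSum.congr_fun (f := _) (hasSum_pi_single 0 (1 : ℂ)) fun n => ?_
  by_cases hn : n = 0 <;> simp [hn]

theorem multipliers_subset_functionsOf :
    multipliers (DiscSpace c) ⊆ functionsOf (DiscSpace c) := by
  rintro m ⟨T, hT⟩
  obtain ⟨f, hf⟩ := exists_apply_eq_one c
  exact ⟨T f, funext fun z => by simp [hT, hf]⟩

/-- Elements of the space are holomorphic. -/
theorem exists_differentiableOn (f : DiscSpace c) :
    ∃ F : ℂ → ℂ, DifferentiableOn ℂ F (Metric.ball 0 1) ∧ ∀ z : 𝔻, f z = F z := by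
  refine ⟨fun z => ∑' n, coeff f n * z ^ n, fun z hz => ?_,
    fun z => (hasSum_apply f z).tsum_eq.symm⟩
  obtain ⟨r, hzr, hr1⟩ := exists_between (mem_ball_zero_iff.1 hz)
  have hr0 : 0 ≤ r := (norm_nonneg z).trans hzr.le
  -- Absolute convergence at the point `r` dominates the series on the whole ball of radius `r`,
  -- which contains `z`.
  have hs := (hasSum_apply f (Complex.UnitDisc.mk (r : ℂ)
    (by rwa [Complex.norm_real, Real.norm_of_nonneg hr0]))).summable.norm
  have hd := Complex.differentiableOn_tsum_of_summable_norm (U := Metric.ball (0 : ℂ) r)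
    (F := fun n w => coeff f n * w ^ n) hs (fun n => by fun_prop) Metric.isOpen_ball
    (fun n w hw => by
      rw [Complex.UnitDisc.coe_mk, norm_mul, norm_mul, norm_pow, norm_pow, Complex.norm_real,
        Real.norm_of_nonneg hr0]
      have := (mem_ball_zero_iff.1 hw).le
      gcongr)
  exact (hd.differentiableAt
    (Metric.isOpen_ball.mem_nhds (mem_ball_zero_iff.2 hzr))).differentiableWithinAt

theorem contractiveMultipliers_subset_boundedHolomorphic :
    contractiveMultipliers (DiscSpace c) ⊆ boundedHolomorphic := by
  intro m hm
  obtain ⟨f, rfl⟩ :=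
    multipliers_subset_functionsOf (contractiveMultipliers_subset_multipliers hm)
  obtain ⟨g, hg⟩ := exists_apply_eq_one c
  exact ⟨exists_differentiableOn f, 1, fun z =>
    norm_le_one_of_mem_contractiveMultipliers hm (f := g) (by simp [hg])⟩

end DiscSpace

/-! ### Monotonicity in the class, and injectivity of the Dirichlet kernel over `[0, 1)` -/

theorem IsZeroSetFor.mono {X : Type*} {A B : Set (X → ℂ)} {S : Set X} (hA : IsZeroSetFor A S)
    (hAB : A ⊆ B) : IsZeroSetFor B S :=
  let ⟨f, hf, hS⟩ := hA
  ⟨f, hAB hf, hS⟩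

/-- Integrate the geometric series in `s u` over `s`. In this form a difference of two values
factors, with no logarithm involved. -/
theorem hasSum_pow_div_succ {u : ℂ} (hu : ‖u‖ < 1) :
    HasSum (fun n : ℕ => (1 / ((n : ℂ) + 1)) * u ^ n) (∫ s in (0 : ℝ)..1, (1 - s * u)⁻¹) := by
  have hle : ∀ s ∈ Set.uIoc (0 : ℝ) 1, ‖(s : ℂ) * u‖ ≤ ‖u‖ := by
    intro s hs
    rw [Set.uIoc_of_le zero_le_one] at hs
    rw [norm_mul, Complex.norm_real, Real.norm_of_nonneg hs.1.le]
    exact mul_le_of_le_one_left (norm_nonneg _) hs.2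
  have h := intervalIntegral.hasSum_integral_of_dominated_convergence
    (μ := MeasureTheory.volume) (a := 0) (b := 1)
    (F := fun (n : ℕ) (s : ℝ) => ((s : ℂ) * u) ^ n) (f := fun s : ℝ => (1 - (s : ℂ) * u)⁻¹)
    (fun n _ => ‖u‖ ^ n) (fun n => (by fun_prop : Continuous _).aestronglyMeasurable)
    (fun n => Eventually.of_forall fun s hs => by
      rw [norm_pow]
      exact pow_le_pow_left₀ (norm_nonneg _) (hle s hs) n)
    (Eventually.of_forall fun _ _ => summable_geometric_of_lt_one (norm_nonneg _) hu)
    intervalIntegrable_const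
    (Eventually.of_forall fun s hs => hasSum_geometric_of_norm_lt_one ((hle s hs).trans_lt hu))
  refine HasSum.congr_fun (f := _) h fun n => ?_
  simp_rw [mul_pow]
  rw [intervalIntegral.integral_mul_const]
  congr 1
  have hpow : (∫ s in (0 : ℝ)..1, (s : ℂ) ^ n) = ((∫ s in (0 : ℝ)..1, s ^ n : ℝ) : ℂ) := by
    rw [← intervalIntegral.integral_ofReal]
    simp
  rw [hpow, integral_pow]
  simp

theorem re_inv_one_sub_pos {u : ℂ} (hu : ‖u‖ < 1) : 0 < ((1 - u)⁻¹).re := by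
  have h1 : 0 < (1 - u).re := by
    have := (Complex.re_le_norm u).trans_lt hu
    simp
    linarith
  rw [Complex.inv_re]
  exact div_pos h1 (Complex.normSq_pos.2 fun h => by simp [h] at h1)

/-- The function `u ↦ (1/u) log (1/(1-u))` takes each of its values on `[0, 1)` only
once. -/
theorem eq_of_tsum_pow_div_succ_eq {u : ℂ} {t : ℝ} (hu : ‖u‖ < 1) (ht0 : 0 ≤ t) (ht1 : t < 1)
    (h : ∑' n : ℕ, (1 / ((n : ℂ) + 1)) * u ^ n = ∑' n : ℕ, (1 / ((n : ℂ) + 1)) * (t : ℂ) ^ n) :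
    u = t := by
  have ht : ‖(t : ℂ)‖ < 1 := by rwa [Complex.norm_real, Real.norm_of_nonneg ht0]
  rw [(hasSum_pow_div_succ hu).tsum_eq, (hasSum_pow_div_succ ht).tsum_eq] at h
  have hlt : ∀ {v : ℂ}, ‖v‖ < 1 → ∀ s ∈ Set.uIcc (0 : ℝ) 1, ‖(s : ℂ) * v‖ < 1 := by
    intro v hv s hs
    rw [Set.uIcc_of_le zero_le_one] at hs
    rw [norm_mul, Complex.norm_real, Real.norm_of_nonneg hs.1]
    exact (mul_le_of_le_one_left (norm_nonneg _) hs.2).trans_lt hv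
  have hne : ∀ {v : ℂ}, ‖v‖ < 1 → ∀ s ∈ Set.uIcc (0 : ℝ) 1, 1 - (s : ℂ) * v ≠ 0 := by
    intro v hv s hs h0
    have := hlt hv s hs
    rw [← sub_eq_zero.1 h0, norm_one] at this
    exact lt_irrefl _ this
  have hcont : ∀ {v : ℂ}, ‖v‖ < 1 →
      ContinuousOn (fun s : ℝ => (1 - (s : ℂ) * v)⁻¹) (Set.uIcc 0 1) := fun hv =>
    ContinuousOn.inv₀ (by fun_prop) (hne hv)
  -- The integrands for `u` and `t` differ by `(u - t) G`. As `t` is real, `G s` is a positive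
  -- multiple of `1 / (1 - s u)` on `(0, 1)`, so its real part is positive and `∫ G ≠ 0`.
  let G : ℝ → ℂ := fun s => s * (1 - (s : ℂ) * t)⁻¹ * (1 - (s : ℂ) * u)⁻¹
  have hG : ContinuousOn G (Set.uIcc 0 1) :=
    ((by fun_prop : Continuous fun s : ℝ => (s : ℂ)).continuousOn.mul (hcont ht)).mul (hcont hu)
  have h1 : (u - t) * ∫ s in (0 : ℝ)..1, G s = 0 := by
    rw [← intervalIntegral.integral_const_mul, ← sub_eq_zero.2 h,
      ← intervalIntegral.integral_sub (hcont hu).intervalIntegrable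
        (hcont ht).intervalIntegrable]
    refine intervalIntegral.integral_congr fun s hs => ?_
    simp only [G]
    rw [inv_sub_inv (hne hu s hs) (hne ht s hs), div_eq_mul_inv, mul_inv]
    ring
  have h2 : 0 < (∫ s in (0 : ℝ)..1, G s).re := by
    have hre : (∫ s in (0 : ℝ)..1, G s).re = ∫ s in (0 : ℝ)..1, (G s).re :=
      (Complex.reCLM.intervalIntegral_comp_comm hG.intervalIntegrable).symm
    rw [hre]
    refine intervalIntegral.intervalIntegral_pos_of_pos_on
      (Complex.continuous_re.comp_continuousOn hG).intervalIntegrable (fun s hs => ?_) zero_lt_one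
    have hst : 0 < 1 - s * t := by nlinarith [hs.1, hs.2]
    have hGs : G s = ((s * (1 - s * t)⁻¹ : ℝ) : ℂ) * (1 - (s : ℂ) * u)⁻¹ := by
      simp [G]
    rw [hGs, Complex.re_ofReal_mul]
    exact mul_pos (mul_pos hs.1 (inv_pos.2 hst)) (re_inv_one_sub_pos
      (hlt hu s (by rw [Set.uIcc_of_le zero_le_one]; exact ⟨hs.1.le, hs.2.le⟩)))
  have h3 : (∫ s in (0 : ℝ)..1, G s) ≠ 0 := fun h0 => by simp [h0] at h2
  exact sub_eq_zero.1 ((mul_eq_zero.1 h1).resolve_right h3)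

/-! ### The Hardy and Dirichlet spaces -/

theorem HardySpace.isZeroSetFor_contractiveMultipliers {S : Set 𝔻}
    (hS : Summable fun x : S => 1 - ‖((x : 𝔻) : ℂ)‖ ^ 2) :
    IsZeroSetFor (contractiveMultipliers HardySpace) S := by
  refine DiscSpace.isZeroSetFor_contractiveMultipliers rfl (fun n => by simp)
    (fun u t hu ht0 ht1 h => ?_) ?_
  · have ht : ‖(t : ℂ)‖ < 1 := by rwa [Complex.norm_real, Real.norm_of_nonneg ht0]
    simpa [tsum_geometric_of_norm_lt_one hu, tsum_geometric_of_norm_lt_one ht] using h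
  · refine (hS.comp_injective (Set.inclusion_injective Set.sdiff_subset)).congr fun x => ?_
    simp [tsum_geometric_of_lt_one (sq_nonneg _) (x : 𝔻).sq_norm_lt_one]

theorem DirichletSpace.isZeroSetFor_contractiveMultipliers {S : Set 𝔻}
    (hS : Summable fun x : (S \ {0} : Set 𝔻) =>
      (Real.log (1 / (1 - ‖((x : 𝔻) : ℂ)‖ ^ 2)))⁻¹) :
    IsZeroSetFor (contractiveMultipliers DirichletSpace) S := by
  have hsq : ∀ n : ℕ, (1 / √((n : ℝ) + 1)) ^ 2 = 1 / ((n : ℝ) + 1) := fun n => by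
    rw [div_pow, Real.sq_sqrt (by positivity), one_pow]
  refine DiscSpace.isZeroSetFor_contractiveMultipliers (by simp) (fun n => ?_)
    (fun u t hu ht0 ht1 h => eq_of_tsum_pow_div_succ_eq hu ht0 ht1 ?_) ?_
  -- Log-convexity of `1 / (n + 1)` amounts to `(n + 1)(n + 3) ≤ (n + 2)²`.
  · rw [hsq, hsq, hsq]
    push_cast
    rw [div_pow, div_mul_div_comm, div_le_div_iff₀ (by positivity) (by positivity)]
    nlinarith
  · have hsq' : ∀ n : ℕ, ((1 / √((n : ℝ) + 1) : ℝ) : ℂ) ^ 2 = 1 / ((n : ℂ) + 1) := fun n => by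
      rw [← Complex.ofReal_pow, hsq]
      push_cast
      rfl
    simpa only [hsq'] using h
  -- With `t = |x|²`, `K(x, x) = -log (1 - t) / t ≥ -log (1 - t)` because `0 < t < 1`.
  · refine hS.of_nonneg_of_le (fun x => inv_nonneg.2 (tsum_nonneg fun n => by positivity))
      fun x => ?_
    simp_rw [hsq]
    set t := ‖((x : 𝔻) : ℂ)‖ ^ 2 with ht
    have ht1 : t < 1 := (x : 𝔻).sq_norm_lt_one
    have ht0 : 0 < t := pow_pos (norm_pos_iff.2 (by simpa using x.2.2)) 2
    have hlog := Real.hasSum_pow_div_log_of_abs_lt_one (x := t) (by rwa [abs_of_pos ht0])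
    have hsum : ∑' n : ℕ, 1 / ((n : ℝ) + 1) * t ^ n = -Real.log (1 - t) / t := by
      refine HasSum.tsum_eq ?_
      refine HasSum.congr_fun (f := _) (hlog.div_const t) fun n => ?_
      field_simp
      ring
    have hl : 0 < -Real.log (1 - t) := by
      rw [neg_pos]
      exact Real.log_neg (by linarith) (by linarith)
    rw [hsum, one_div, Real.log_inv]
    refine inv_anti₀ hl ?_
    rw [le_div_iff₀ ht0]
    exact mul_le_of_le_one_right hl.le ht1.le

theorem mainTheorem7 (S : Set 𝔻) :
    ((Summable fun x : S => 1 - ‖((x : 𝔻) : ℂ)‖ ^ 2) →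
      IsZeroSetFor (functionsOf HardySpace) S ∧
      IsZeroSetFor (multipliers HardySpace) S ∧
      IsZeroSetFor boundedHolomorphic S) ∧
    ((Summable fun x : (S \ {0} : Set 𝔻) => (Real.log (1 / (1 - ‖((x : 𝔻) : ℂ)‖ ^ 2)))⁻¹) →
      IsZeroSetFor (functionsOf DirichletSpace) S ∧
      IsZeroSetFor (multipliers DirichletSpace) S) := by
  refine ⟨fun hS => ?_, fun hS => ?_⟩
  · have h := HardySpace.isZeroSetFor_contractiveMultipliers hS
    have hM := h.mono contractiveMultipliers_subset_multipliers
    exact ⟨hM.mono DiscSpace.multipliers_subset_functionsOf, hM,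
      h.mono DiscSpace.contractiveMultipliers_subset_boundedHolomorphic⟩
  · have hM := (DirichletSpace.isZeroSetFor_contractiveMultipliers hS).mono
      contractiveMultipliers_subset_multipliers
    exact ⟨hM.mono DiscSpace.multipliers_subset_functionsOf, hM⟩
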